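/- For real parameters $a,b,c>0$ with $a+b\ge c$ let $$\mu_{a,b,c}(r)=\frac{B(a,b)}{2}\,\frac{F(a,b;c;1-r^2)}{F(a,b;c;r^2)},\qquad r\in(0,1),$$ where $B$ is Euler's beta function and $F={}_2F_1$ is the Gaussian hypergeometric function, $F(a,b;c;x)=\sum_{n\ge 0}\frac{(a)_n(b)_n}{(c)_n\,n!}x^n$ for $|x|<1$. For $0<a<c$ put $\mu_{a,c}=\mu_{a,c-a,c}$. **Theorem.** Let $0<a<c\le 1$ and write $\mu=\mu_{a,c}$. Then $\mu$ is differentiable on $(0,1)$, the function $r\mapsto(1-r)\mu'(r)$ is strictly increasing on $(0,1)$, and the function $r\mapsto r\mu'(r)$ is strictly decreasing on $(0,1)$. Moreover, the inequalities $$\mu\left(1-\sqrt{(1-u)(1-t)}\right)\le\frac{\mu(u)+\mu(t)}{2}\le\mu\left(\sqrt{ut}\right)$$ hold for all $u,t\in(0,1)$, and in each of the two inequalities equality holds if and only if $u=t$. -/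

import Mathlib

/-- The generalized modulus `μ_{a,b,c}(r) = (B(a,b)/2) · F(a,b;c;r'²) / F(a,b;c;r²)`, `0 < r < 1`,
where `r' = √(1 - r²)` is the complementary argument, `B` is the beta function and
`F` is the Gaussian hypergeometric function. -/
noncomputable def genModulus (a b c r : ℝ) : ℝ :=
  ProbabilityTheory.beta a b / 2 *
    (₂F₁ a b c (Real.sqrt (1 - r ^ 2) ^ 2) / ₂F₁ a b c (r ^ 2))

/-- The two-parameter generalized modulus `μ_{a,c} = μ_{a,c-a,c}`. -/
noncomputable def genModulusTwo (a c r : ℝ) : ℝ :=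
  genModulus a (c - a) c r

/-! Write F for `₂F₁ a (c - a) c`, H = (1-x)F' and M for `legendreM`. Differentiating the quotient
gives μ'(r) = -B M(x)/(r(1-x)F(x)²) at x = r², so both monotonicity claims concern M/F² with
elementary weights. The hypergeometric equation becomes the first-order system (1-x)F' = H, xH' =
a(c-a)F - cH, whence M' = (1-c)(H(x)F(1-x) - H(1-x)F(x)).

For rμ', the sign of the derivative follows from 2H < cF, which holds coefficientwise. For (1-r)μ',
it suffices that 2xM' ≤ M, which reduces to xH(x)F(1-x) ≤ (1+x)H(1-x)F(x); near x = 1 this needs H ≤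
2H(0).

Since rμ'(r) is the derivative of μ(exp s) at s = log r, its strict decrease is strict concavity of
μ in log r, giving the right-hand inequality. The left-hand one is the same fact for r ↦ -μ(1-r). -/

open Set Filter Topology

section

variable {a c : ℝ}

/-! ### Concavity in the logarithmic variable -/

/-- If `g` is differentiable on `(0,1)` and `r ↦ r g'(r)` is strictly decreasing, then `g` is strictly
concave with respect to the geometric mean. -/
theorem strict_geom_midpoint_concave {g : ℝ → ℝ} (hg : DifferentiableOn ℝ g (Ioo 0 1))
    (h : StrictAntiOn (fun r : ℝ => r * deriv g r) (Ioo 0 1)) {u t : ℝ}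
    (hu : u ∈ Ioo (0 : ℝ) 1) (ht : t ∈ Ioo (0 : ℝ) 1) (hne : u ≠ t) :
    (g u + g t) / 2 < g (Real.sqrt (u * t)) := by
  have hmem : ∀ s ∈ Iio (0 : ℝ), Real.exp s ∈ Ioo (0 : ℝ) 1 := fun s hs =>
    ⟨Real.exp_pos s, Real.exp_lt_one_iff.2 hs⟩
  have hd : ∀ s ∈ Iio (0 : ℝ), HasDerivAt (fun s => g (Real.exp s))
      (Real.exp s * deriv g (Real.exp s)) s := by
    intro s hs
    have h1 := ((hg _ (hmem s hs)).differentiableAt (Ioo_mem_nhds (hmem s hs).1 (hmem s hs).2)).hasDerivAt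
    have := h1.comp s (Real.hasDerivAt_exp s)
    rwa [mul_comm] at this
  have hconc : StrictConcaveOn ℝ (Iio (0 : ℝ)) (fun s => g (Real.exp s)) := by
    refine StrictAntiOn.strictConcaveOn_of_deriv (convex_Iio 0)
      (fun s hs => (hd s hs).continuousAt.continuousWithinAt) ?_
    rw [interior_Iio]
    intro s hs s' hs' hlt
    rw [(hd s hs).deriv, (hd s' hs').deriv]
    exact h (hmem s hs) (hmem s' hs') (Real.exp_lt_exp.2 hlt)
  have hlne : Real.log u ≠ Real.log t := fun he => hne (Real.log_injOn_pos hu.1 ht.1 he)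
  have key := hconc.2 (Real.log_neg hu.1 hu.2) (Real.log_neg ht.1 ht.2) hlne
    (by norm_num : (0 : ℝ) < 1 / 2) (by norm_num : (0 : ℝ) < 1 / 2) (by norm_num)
  have hs : Real.exp (1 / 2 * Real.log u + 1 / 2 * Real.log t) = Real.sqrt (u * t) := by
    rw [← mul_add, ← Real.log_mul hu.1.ne' ht.1.ne', mul_comm,
      Real.sqrt_eq_rpow, Real.rpow_def_of_pos (mul_pos hu.1 ht.1)]
  simp only [Real.exp_log hu.1, Real.exp_log ht.1, smul_eq_mul] at key
  rw [hs] at key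
  linarith

/-! ### Power series with coefficients in [0,1] -/

/-- Termwise differentiation of a power series with coefficients in `[0,1]`. -/
theorem hasDerivAt_tsum_pow {f : ℕ → ℝ} (h0 : ∀ n, 0 ≤ f n) (h1 : ∀ n, f n ≤ 1) {x : ℝ}
    (hx : |x| < 1) :
    HasDerivAt (fun y => ∑' n, f n * y ^ n) (∑' n : ℕ, f n * (n * x ^ (n - 1))) x := by
  obtain ⟨ρ, hxρ, hρ⟩ := exists_between hx
  have hρ0 : 0 < ρ := (abs_nonneg x).trans_lt hxρ
  have hsum : Summable (fun n : ℕ => (n : ℝ) * ρ ^ (n - 1)) := by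
    have := (summable_pow_mul_geometric_of_norm_lt_one 1
      (by rwa [Real.norm_of_nonneg hρ0.le] : ‖ρ‖ < 1)).mul_right ρ⁻¹
    refine this.congr fun n => ?_
    rcases n with _ | n
    · simp
    · simp only [pow_succ, Nat.add_sub_cancel]
      field_simp
  refine hasDerivAt_tsum_of_isPreconnected (t := Ioo (-ρ) ρ) (y₀ := 0) hsum isOpen_Ioo
    isPreconnected_Ioo (fun n y _ => (hasDerivAt_pow n y).const_mul (f n)) ?_ ⟨by linarith, hρ0⟩
    ?_ (abs_lt.1 hxρ)
  · intro n y hy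
    rw [norm_mul, norm_mul, norm_pow, Real.norm_of_nonneg (h0 n),
      Real.norm_of_nonneg (Nat.cast_nonneg n)]
    have : ‖y‖ ^ (n - 1) ≤ ρ ^ (n - 1) :=
      pow_le_pow_left₀ (norm_nonneg y) (abs_lt.2 hy).le _
    have h2 : 0 ≤ (n : ℝ) * ‖y‖ ^ (n - 1) := by positivity
    calc f n * (n * ‖y‖ ^ (n - 1)) ≤ 1 * (n * ‖y‖ ^ (n - 1)) := by gcongr; exact h1 n
      _ ≤ n * ρ ^ (n - 1) := by rw [one_mul]; gcongr
  -- At the base point 0 only the constant term survives.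
  · refine summable_of_ne_finset_zero (s := {0}) fun n hn => ?_
    simp at hn
    simp [hn]

theorem summable_mul_pow {f : ℕ → ℝ} (h0 : ∀ n, 0 ≤ f n) (h1 : ∀ n, f n ≤ 1) {x : ℝ}
    (hx : x ∈ Ico (0 : ℝ) 1) : Summable (fun n => f n * x ^ n) :=
  Summable.of_nonneg_of_le (fun n => mul_nonneg (h0 n) (pow_nonneg hx.1 n))
    (fun n => mul_le_of_le_one_left (pow_nonneg hx.1 n) (h1 n))
    (summable_geometric_of_lt_one hx.1 hx.2)

theorem summable_mul_nat_mul_pow {f : ℕ → ℝ} (h0 : ∀ n, 0 ≤ f n) (h1 : ∀ n, f n ≤ 1) {x : ℝ}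
    (hx : x ∈ Ioo (0 : ℝ) 1) : Summable (fun n : ℕ => f n * (n * x ^ (n - 1))) := by
  have := (summable_pow_mul_geometric_of_norm_lt_one 1
      (by rw [Real.norm_of_nonneg hx.1.le]; exact hx.2 : ‖x‖ < 1)).mul_right x⁻¹
  refine Summable.of_nonneg_of_le (fun n => ?_) (fun n => ?_) this
  · have := h0 n; have := hx.1; positivity
  · have hp : (n : ℝ) ^ 1 * x ^ n * x⁻¹ = n * x ^ (n - 1) := by
      have := hx.1.ne'
      rcases n with _ | n
      · simp
      · simp only [pow_succ, Nat.add_sub_cancel]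
        field_simp
    rw [hp]
    exact mul_le_of_le_one_left (by have := hx.1; positivity) (h1 n)

theorem mul_tsum_nat_mul_pow (f : ℕ → ℝ) (x : ℝ) :
    x * ∑' n : ℕ, f n * (n * x ^ (n - 1)) = ∑' n : ℕ, n * f n * x ^ n := by
  rw [← tsum_mul_left]
  refine tsum_congr fun n => ?_
  rcases n with _ | n
  · simp
  · simp only [pow_succ, Nat.add_sub_cancel]
    ring

/-! ### Coefficients of F and H -/

/-- The coefficients of `₂F₁(a, c - a; c; x)`. -/
noncomputable abbrev zeroBalancedCoeff (a c : ℝ) (n : ℕ) : ℝ :=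
  ordinaryHypergeometricCoefficient a (c - a) c n

/-- The coefficients of `(1 - x) (d/dx) ₂F₁(a, c - a; c; x)`. -/
noncomputable def zeroBalancedSlopeCoeff (a c : ℝ) (n : ℕ) : ℝ :=
  a * (c - a) / (c + n) * zeroBalancedCoeff a c n

/-- The function `(1 - x) (d/dx) ₂F₁(a, c - a; c; x)`, as a power series. -/
noncomputable def zeroBalancedSlope (a c x : ℝ) : ℝ :=
  ∑' n : ℕ, zeroBalancedSlopeCoeff a c n * x ^ n


theorem zeroBalancedCoeff_zero (a c : ℝ) : zeroBalancedCoeff a c 0 = 1 := by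
  simp [zeroBalancedCoeff, ordinaryHypergeometricCoefficient]

theorem zeroBalancedCoeff_pos (ha : 0 < a) (hac : a < c) (n : ℕ) :
    0 < zeroBalancedCoeff a c n := by
  have h1 := ascPochhammer_pos n a ha
  have h2 := ascPochhammer_pos n (c - a) (sub_pos.2 hac)
  have h3 := ascPochhammer_pos n c (ha.trans hac)
  have : (0 : ℝ) < n.factorial := by positivity
  unfold zeroBalancedCoeff ordinaryHypergeometricCoefficient
  positivity

/-- Coefficient form of F' = xF' + H. -/
theorem zeroBalancedCoeff_succ (ha : 0 < a) (hac : a < c) (n : ℕ) :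
    (n + 1) * zeroBalancedCoeff a c (n + 1)
      = n * zeroBalancedCoeff a c n + zeroBalancedSlopeCoeff a c n := by
  have h3 := (ascPochhammer_pos n c (ha.trans hac)).ne'
  have h4 : c + n ≠ 0 := by have := ha.trans hac; positivity
  have h5 : (n.factorial : ℝ) ≠ 0 := by positivity
  have h6 : (n : ℝ) + 1 ≠ 0 := by positivity
  simp only [zeroBalancedSlopeCoeff, zeroBalancedCoeff, ordinaryHypergeometricCoefficient,
    ascPochhammer_succ_eval, Nat.factorial_succ, Nat.cast_mul, Nat.cast_add, Nat.cast_one]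
  field_simp
  ring

theorem zeroBalancedSlopeCoeff_pos (ha : 0 < a) (hac : a < c) (n : ℕ) :
    0 < zeroBalancedSlopeCoeff a c n := by
  have h1 := zeroBalancedCoeff_pos ha hac n
  have h2 := sub_pos.2 hac
  have h3 := ha.trans hac
  unfold zeroBalancedSlopeCoeff
  positivity

/-- Coefficient form of xH' = a(c-a)F - cH. -/
theorem cast_mul_zeroBalancedSlopeCoeff (ha : 0 < a) (hac : a < c) (n : ℕ) :
    n * zeroBalancedSlopeCoeff a c n
      = a * (c - a) * zeroBalancedCoeff a c n - c * zeroBalancedSlopeCoeff a c n := by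
  have h4 : c + n ≠ 0 := by have := ha.trans hac; positivity
  unfold zeroBalancedSlopeCoeff
  field_simp
  ring

/-- By AM-GM, 2a(c-a) ≤ c²/2 < c(c+n). -/
theorem two_mul_zeroBalancedSlopeCoeff_lt (ha : 0 < a) (hac : a < c) (n : ℕ) :
    2 * zeroBalancedSlopeCoeff a c n < c * zeroBalancedCoeff a c n := by
  have h4 : 0 < c + n := by have := ha.trans hac; positivity
  have h5 : (0 : ℝ) ≤ n := n.cast_nonneg
  have h6 := ha.trans hac
  unfold zeroBalancedSlopeCoeff
  rw [← mul_assoc]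
  refine mul_lt_mul_of_pos_right ?_ (zeroBalancedCoeff_pos ha hac n)
  rw [← mul_div_assoc, div_lt_iff₀ h4]
  nlinarith [sq_nonneg (c - 2 * a), mul_nonneg h6.le h5]

theorem zeroBalancedCoeff_le_one (ha : 0 < a) (hac : a < c) (hc : c ≤ 1) (n : ℕ) :
    zeroBalancedCoeff a c n ≤ 1 := by
  induction n with
  | zero => rw [zeroBalancedCoeff_zero]
  | succ n ih =>
    have h1 := zeroBalancedCoeff_succ ha hac n
    have h2 := two_mul_zeroBalancedSlopeCoeff_lt ha hac n
    have h3 := zeroBalancedCoeff_pos ha hac n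
    have h4 : (0 : ℝ) < n + 1 := by positivity
    have h5 := zeroBalancedSlopeCoeff_pos ha hac n
    have h6 : (n + 1) * zeroBalancedCoeff a c (n + 1) ≤ (n + 1) * 1 := by nlinarith
    exact le_of_mul_le_mul_left h6 h4

theorem zeroBalancedSlopeCoeff_le_one (ha : 0 < a) (hac : a < c) (hc : c ≤ 1) (n : ℕ) :
    zeroBalancedSlopeCoeff a c n ≤ 1 := by
  have h1 := zeroBalancedCoeff_le_one ha hac hc n
  have h2 := two_mul_zeroBalancedSlopeCoeff_lt ha hac n
  have h3 := zeroBalancedCoeff_pos ha hac n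
  nlinarith

theorem sum_zeroBalancedSlopeCoeff (ha : 0 < a) (hac : a < c) (n : ℕ) :
    ∑ k ∈ Finset.range n, zeroBalancedSlopeCoeff a c k = n * zeroBalancedCoeff a c n := by
  induction n with
  | zero => simp
  | succ n ih =>
    rw [Finset.sum_range_succ, ih, Nat.cast_add, Nat.cast_one, zeroBalancedCoeff_succ ha hac]

/-- The left side is a partial sum of the coefficients of H, so this bounds H by 2H(0). With m =
n+1, each step multiplies it by 1 + q, where q = a(c-a)/(m(c+m)) ≤ 1/(2m(m+1)); then (2 - 1/m)(1 +
q) ≤ 2 - 1/m + 2q, and 2q is absorbed by 1/m - 1/(m+1). -/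
theorem succ_mul_zeroBalancedCoeff_succ_le (ha : 0 < a) (hac : a < c) (hc : c ≤ 1) (n : ℕ) :
    (n + 1) * zeroBalancedCoeff a c (n + 1)
      ≤ (2 - 1 / (n + 1)) * zeroBalancedSlopeCoeff a c 0 := by
  induction n with
  | zero =>
    have := zeroBalancedCoeff_succ ha hac 0
    norm_num at this ⊢
    rw [this]
  | succ n ih =>
    have h0 := zeroBalancedSlopeCoeff_pos ha hac 0
    have h1 := zeroBalancedCoeff_succ ha hac (n + 1)
    have hp : a * (c - a) ≤ 1 / 4 := by nlinarith [sq_nonneg (c - 2 * a)]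
    have hp0 : 0 < a * (c - a) := mul_pos ha (sub_pos.2 hac)
    have hm : (0 : ℝ) < n + 1 := by positivity
    have hn : (0 : ℝ) ≤ n := n.cast_nonneg
    have hc0 := ha.trans hac
    have hfac : (n + 1 : ℕ) * zeroBalancedCoeff a c (n + 1) + zeroBalancedSlopeCoeff a c (n + 1)
        = (1 + a * (c - a) / ((n + 1) * (c + (n + 1))))
          * ((n + 1) * zeroBalancedCoeff a c (n + 1)) := by
      unfold zeroBalancedSlopeCoeff
      push_cast
      field_simp
    rw [h1, hfac]
    calc _ ≤ (1 + a * (c - a) / ((n + 1) * (c + (n + 1))))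
          * ((2 - 1 / (n + 1)) * zeroBalancedSlopeCoeff a c 0) := by gcongr
      _ ≤ _ := by
        rw [← mul_assoc]
        refine mul_le_mul_of_nonneg_right ?_ h0.le
        have hq : a * (c - a) / ((n + 1) * (c + (n + 1))) ≤ 1 / (2 * (n + 1) * (n + 2)) := by
          rw [div_le_div_iff₀ (by positivity) (by positivity)]
          have : a * (c - a) * (2 * (n + 2)) ≤ c + (n + 1) := by nlinarith
          nlinarith
        have hq2 : (0 : ℝ) ≤ 1 / (n + 1) := by positivity
        have hq3 : 0 ≤ a * (c - a) / ((n + 1) * (c + (n + 1))) := by positivity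
        have hq4 : (1 : ℝ) / (n + 1) - 1 / (n + 2) = 2 * (1 / (2 * (n + 1) * (n + 2))) := by
          field_simp
          ring
        have hq5 : (((n + 1 : ℕ) : ℝ) + 1) = n + 2 := by push_cast; ring
        rw [hq5]
        nlinarith [mul_nonneg hq2 hq3]

/-! ### Bounds for F and H on [0,1) -/

theorem hypergeom_eq_tsum (a c x : ℝ) :
    ₂F₁ a (c - a) c x = ∑' n, zeroBalancedCoeff a c n * x ^ n := by
  rw [ordinaryHypergeometric_eq_tsum]
  simp only [smul_eq_mul]

theorem zeroBalancedSlope_le (ha : 0 < a) (hac : a < c) (hc : c ≤ 1) {x : ℝ}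
    (hx : x ∈ Ico (0 : ℝ) 1) : zeroBalancedSlope a c x ≤ 2 * zeroBalancedSlopeCoeff a c 0 := by
  have hpos := fun n => (zeroBalancedSlopeCoeff_pos ha hac n).le
  refine Real.tsum_le_of_sum_range_le (fun n => mul_nonneg (hpos n) (pow_nonneg hx.1 n))
    fun n => ?_
  calc ∑ k ∈ Finset.range n, zeroBalancedSlopeCoeff a c k * x ^ k
      ≤ ∑ k ∈ Finset.range n, zeroBalancedSlopeCoeff a c k :=
        Finset.sum_le_sum fun k _ => mul_le_of_le_one_right (hpos k) (pow_le_one₀ hx.1 hx.2.le)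
    _ = n * zeroBalancedCoeff a c n := sum_zeroBalancedSlopeCoeff ha hac n
    _ ≤ 2 * zeroBalancedSlopeCoeff a c 0 := by
      rcases n with _ | n
      · simpa using hpos 0
      · push_cast
        refine (succ_mul_zeroBalancedCoeff_succ_le ha hac hc n).trans ?_
        have : (0 : ℝ) ≤ 1 / (n + 1) := by positivity
        nlinarith [hpos 0]

theorem le_zeroBalancedSlope (ha : 0 < a) (hac : a < c) (hc : c ≤ 1) {x : ℝ}
    (hx : x ∈ Ico (0 : ℝ) 1) : zeroBalancedSlopeCoeff a c 0 ≤ zeroBalancedSlope a c x := by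
  have hpos := fun n => (zeroBalancedSlopeCoeff_pos ha hac n).le
  have := (summable_mul_pow hpos (zeroBalancedSlopeCoeff_le_one ha hac hc) hx).le_tsum 0
    (fun n _ => mul_nonneg (hpos n) (pow_nonneg hx.1 n))
  simpa [zeroBalancedSlope] using this

theorem zeroBalancedSlope_pos (ha : 0 < a) (hac : a < c) (hc : c ≤ 1) {x : ℝ}
    (hx : x ∈ Ico (0 : ℝ) 1) : 0 < zeroBalancedSlope a c x :=
  (zeroBalancedSlopeCoeff_pos ha hac 0).trans_le (le_zeroBalancedSlope ha hac hc hx)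

theorem one_le_hypergeom (ha : 0 < a) (hac : a < c) (hc : c ≤ 1) {x : ℝ}
    (hx : x ∈ Ico (0 : ℝ) 1) : 1 ≤ ₂F₁ a (c - a) c x := by
  have hpos := fun n => (zeroBalancedCoeff_pos ha hac n).le
  have := (summable_mul_pow hpos (zeroBalancedCoeff_le_one ha hac hc) hx).le_tsum 0
    (fun n _ => mul_nonneg (hpos n) (pow_nonneg hx.1 n))
  rw [zeroBalancedCoeff_zero] at this
  rw [hypergeom_eq_tsum]
  simpa using this

theorem hypergeom_mul_one_sub_le (ha : 0 < a) (hac : a < c) (hc : c ≤ 1) {x : ℝ}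
    (hx : x ∈ Ico (0 : ℝ) 1) : (1 - x) * ₂F₁ a (c - a) c x ≤ 1 := by
  have hpos := fun n => (zeroBalancedCoeff_pos ha hac n).le
  have h1 := zeroBalancedCoeff_le_one ha hac hc
  have : ₂F₁ a (c - a) c x ≤ (1 - x)⁻¹ := by
    rw [hypergeom_eq_tsum, ← tsum_geometric_of_lt_one hx.1 hx.2]
    exact (summable_mul_pow hpos h1 hx).tsum_le_tsum
      (fun n => mul_le_of_le_one_left (pow_nonneg hx.1 n) (h1 n))
      (summable_geometric_of_lt_one hx.1 hx.2)
  have hx' : 0 < 1 - x := sub_pos.2 hx.2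
  calc _ ≤ (1 - x) * (1 - x)⁻¹ := by gcongr
    _ = 1 := mul_inv_cancel₀ hx'.ne'

theorem tsum_mul_pow_le {f : ℕ → ℝ} (h0 : ∀ n, 0 ≤ f n) (h1 : ∀ n, f n ≤ 1) {x y : ℝ}
    (hx : 0 ≤ x) (hxy : x ≤ y) (hy : y < 1) :
    ∑' n, f n * x ^ n ≤ ∑' n, f n * y ^ n :=
  (summable_mul_pow h0 h1 ⟨hx, hxy.trans_lt hy⟩).tsum_le_tsum
    (fun n => mul_le_mul_of_nonneg_left (pow_le_pow_left₀ hx hxy n) (h0 n))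
    (summable_mul_pow h0 h1 ⟨hx.trans hxy, hy⟩)

theorem two_mul_zeroBalancedSlope_lt (ha : 0 < a) (hac : a < c) (hc : c ≤ 1) {x : ℝ}
    (hx : x ∈ Ico (0 : ℝ) 1) :
    2 * zeroBalancedSlope a c x < c * ₂F₁ a (c - a) c x := by
  rw [hypergeom_eq_tsum, zeroBalancedSlope, ← tsum_mul_left, ← tsum_mul_left]
  have hlt := two_mul_zeroBalancedSlopeCoeff_lt ha hac
  refine Summable.tsum_lt_tsum (i := 0) (fun n => ?_) ?_
    ((summable_mul_pow (fun n => (zeroBalancedSlopeCoeff_pos ha hac n).le)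
      (zeroBalancedSlopeCoeff_le_one ha hac hc) hx).mul_left 2)
    ((summable_mul_pow (fun n => (zeroBalancedCoeff_pos ha hac n).le)
      (zeroBalancedCoeff_le_one ha hac hc) hx).mul_left c)
  · rw [← mul_assoc, ← mul_assoc]
    exact mul_le_mul_of_nonneg_right (hlt n).le (pow_nonneg hx.1 n)
  · simpa using hlt 0

/-! ### The differential system for F and H -/

theorem hasDerivAt_hypergeom (ha : 0 < a) (hac : a < c) (hc : c ≤ 1) {x : ℝ}
    (hx : x ∈ Ioo (0 : ℝ) 1) :
    HasDerivAt (₂F₁ a (c - a) c) (zeroBalancedSlope a c x / (1 - x)) x := by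
  have hpos := fun n => (zeroBalancedCoeff_pos ha hac n).le
  have h1 := zeroBalancedCoeff_le_one ha hac hc
  have hd := hasDerivAt_tsum_pow hpos h1 (abs_lt.2 ⟨by linarith [hx.1], hx.2⟩ : |x| < 1)
  have hsum := summable_mul_nat_mul_pow hpos h1 hx
  have hF : ₂F₁ a (c - a) c = fun y => ∑' n, zeroBalancedCoeff a c n * y ^ n :=
    funext (hypergeom_eq_tsum a c)
  rw [hF]
  convert hd using 1
  rw [div_eq_iff (sub_pos.2 hx.2).ne', mul_comm, sub_mul, one_mul, mul_tsum_nat_mul_pow,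
    hsum.tsum_eq_zero_add, zeroBalancedSlope]
  have hs2 : Summable fun n : ℕ => n * zeroBalancedCoeff a c n * x ^ n := by
    refine (hsum.mul_left x).congr fun n => ?_
    rcases n with _ | n
    · simp
    · simp only [pow_succ, Nat.add_sub_cancel]
      ring
  rw [Nat.cast_zero, zero_mul, mul_zero, zero_add,
    ← ((summable_nat_add_iff 1).2 hsum).tsum_sub hs2]
  refine tsum_congr fun n => ?_
  have := zeroBalancedCoeff_succ ha hac n
  rw [Nat.add_sub_cancel]
  push_cast
  linear_combination -(x ^ n) * this

theorem hasDerivAt_zeroBalancedSlope (ha : 0 < a) (hac : a < c) (hc : c ≤ 1) {x : ℝ}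
    (hx : x ∈ Ioo (0 : ℝ) 1) :
    HasDerivAt (zeroBalancedSlope a c)
      ((a * (c - a) * ₂F₁ a (c - a) c x - c * zeroBalancedSlope a c x) / x) x := by
  have hpos := fun n => (zeroBalancedSlopeCoeff_pos ha hac n).le
  have h1 := zeroBalancedSlopeCoeff_le_one ha hac hc
  have hd := hasDerivAt_tsum_pow hpos h1 (abs_lt.2 ⟨by linarith [hx.1], hx.2⟩ : |x| < 1)
  have hH : zeroBalancedSlope a c = fun y => ∑' n, zeroBalancedSlopeCoeff a c n * y ^ n := rfl
  rw [hH]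
  convert hd using 1
  rw [div_eq_iff hx.1.ne', mul_comm _ x, mul_tsum_nat_mul_pow, hypergeom_eq_tsum,
    ← tsum_mul_left, ← tsum_mul_left, ← Summable.tsum_sub]
  · refine tsum_congr fun n => ?_
    linear_combination -(x ^ n) * cast_mul_zeroBalancedSlopeCoeff ha hac n
  · exact (summable_mul_pow (fun n => (zeroBalancedCoeff_pos ha hac n).le)
      (zeroBalancedCoeff_le_one ha hac hc) ⟨hx.1.le, hx.2⟩).mul_left _
  · exact (summable_mul_pow hpos h1 ⟨hx.1.le, hx.2⟩).mul_left _

/-! ### The generalized Legendre function M -/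

/-- The generalized Legendre function
`x (1 - x) (F'(x) F(1 - x) + F(x) F'(1 - x))` of `F = ₂F₁(a, c - a; c; ·)`. -/
noncomputable def legendreM (a c x : ℝ) : ℝ :=
  (1 - x) * zeroBalancedSlope a c (1 - x) * ₂F₁ a (c - a) c x
    + x * zeroBalancedSlope a c x * ₂F₁ a (c - a) c (1 - x)

theorem one_sub_mem_Ioo {x : ℝ} (hx : x ∈ Ioo (0 : ℝ) 1) : 1 - x ∈ Ioo (0 : ℝ) 1 :=
  ⟨by linarith [hx.2], by linarith [hx.1]⟩

theorem sq_mem_Ioo {r : ℝ} (hr : r ∈ Ioo (0 : ℝ) 1) : r ^ 2 ∈ Ioo (0 : ℝ) 1 :=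
  ⟨pow_pos hr.1 2, pow_lt_one₀ hr.1.le hr.2 two_ne_zero⟩

theorem hasDerivAt_hypergeom_one_sub (ha : 0 < a) (hac : a < c) (hc : c ≤ 1) {x : ℝ}
    (hx : x ∈ Ioo (0 : ℝ) 1) :
    HasDerivAt (fun x => ₂F₁ a (c - a) c (1 - x)) (-(zeroBalancedSlope a c (1 - x) / x)) x := by
  have := (hasDerivAt_hypergeom ha hac hc (one_sub_mem_Ioo hx)).comp_const_sub 1 x
  rwa [sub_sub_cancel] at this

/-- The a(c-a)F(x)F(1-x) terms and those carrying H(x)H(1-x) cancel. For c = 1 the derivative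
vanishes, as in Legendre's relation. -/
theorem hasDerivAt_legendreM (ha : 0 < a) (hac : a < c) (hc : c ≤ 1) {x : ℝ}
    (hx : x ∈ Ioo (0 : ℝ) 1) :
    HasDerivAt (legendreM a c) ((1 - c) * (zeroBalancedSlope a c x * ₂F₁ a (c - a) c (1 - x)
      - zeroBalancedSlope a c (1 - x) * ₂F₁ a (c - a) c x)) x := by
  have hF := hasDerivAt_hypergeom ha hac hc hx
  have hF' := hasDerivAt_hypergeom_one_sub ha hac hc hx
  have hH := hasDerivAt_zeroBalancedSlope ha hac hc hx
  have hH' := (hasDerivAt_zeroBalancedSlope ha hac hc (one_sub_mem_Ioo hx)).comp_const_sub 1 x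
  have hx0 := hx.1.ne'
  have hx1 := (sub_pos.2 hx.2).ne'
  have := ((((hasDerivAt_id x).const_sub 1).mul hH').mul hF).add
    (((hasDerivAt_id x).mul hH).mul hF')
  refine this.congr_deriv ?_
  simp only [id, Pi.mul_apply]
  field_simp
  ring

theorem legendreM_pos (ha : 0 < a) (hac : a < c) (hc : c ≤ 1) {x : ℝ}
    (hx : x ∈ Ioo (0 : ℝ) 1) : 0 < legendreM a c x := by
  have hx' := one_sub_mem_Ioo hx
  have h1 := one_le_hypergeom ha hac hc (Ioo_subset_Ico_self hx)
  have h2 := one_le_hypergeom ha hac hc (Ioo_subset_Ico_self hx')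
  have h3 := zeroBalancedSlope_pos ha hac hc (Ioo_subset_Ico_self hx)
  have h4 := zeroBalancedSlope_pos ha hac hc (Ioo_subset_Ico_self hx')
  have h5 := hx.1
  have h6 := hx'.1
  unfold legendreM
  positivity

/-! ### Monotonicity of the two weighted quotients M/F² -/

theorem strictMonoOn_legendreM_div (ha : 0 < a) (hac : a < c) (hc : c ≤ 1) :
    StrictMonoOn (fun x => legendreM a c x / ((1 - x) * ₂F₁ a (c - a) c x ^ 2)) (Ioo 0 1) := by
  have hd : ∀ x ∈ Ioo (0 : ℝ) 1, ∃ d, 0 < d ∧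
      HasDerivAt (fun x => legendreM a c x / ((1 - x) * ₂F₁ a (c - a) c x ^ 2)) d x := by
    intro x hx
    have hx' := one_sub_mem_Ioo hx
    have hF := hasDerivAt_hypergeom ha hac hc hx
    have hM := hasDerivAt_legendreM ha hac hc hx
    have h1 := one_le_hypergeom ha hac hc (Ioo_subset_Ico_self hx)
    have h2 := one_le_hypergeom ha hac hc (Ioo_subset_Ico_self hx')
    have h3 := zeroBalancedSlope_pos ha hac hc (Ioo_subset_Ico_self hx)
    have h4 := zeroBalancedSlope_pos ha hac hc (Ioo_subset_Ico_self hx')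
    have h5 := two_mul_zeroBalancedSlope_lt ha hac hc (Ioo_subset_Ico_self hx)
    have hx0 := hx.1
    have hx1 := hx'.1
    have hF0 : 0 < ₂F₁ a (c - a) c x := by linarith
    have hden : (1 - x) * ₂F₁ a (c - a) c x ^ 2 ≠ 0 := by positivity
    refine ⟨_, ?_, hM.div (((hasDerivAt_id x).const_sub 1).mul (hF.pow 2)) hden⟩
    simp only [id, legendreM]
    generalize ₂F₁ a (c - a) c x = F at *
    generalize ₂F₁ a (c - a) c (1 - x) = G at *
    generalize zeroBalancedSlope a c x = H at *
    generalize zeroBalancedSlope a c (1 - x) = K at *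
    refine div_pos ?_ (by positivity)
    -- The numerator F·(M'(1-x)F + M(F - 2H)), regrouped by the two summands of M: the (1-c) loss in
    -- the first turns F - 2H into cF - 2H.
    have key : 0 < F * ((1 - x) * K * F * (c * F - 2 * H)
        + H * G * ((1 - c) * (1 - x) * F + x * (F - 2 * H))) := by
      have e1 : 0 < c * F - 2 * H := by linarith
      have e2 : 0 < F - 2 * H := by nlinarith
      have e3 : 0 ≤ 1 - c := by linarith
      positivity
    refine key.trans_eq ?_
    push_cast
    field_simp
    ring
  refine strictMonoOn_of_deriv_pos (convex_Ioo 0 1) (fun x hx => ?_) fun x hx => ?_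
  · obtain ⟨d, -, h⟩ := hd x hx
    exact h.continuousAt.continuousWithinAt
  · rw [interior_Ioo] at hx
    obtain ⟨d, h0, h⟩ := hd x hx
    rwa [h.deriv]

/-- For x ≤ 1/2, monotonicity of H and xF(1-x) ≤ 1 suffice. For x ≥ 1/2, F(1-x) ≤ F(x), and H(x) ≤
2H(0) ≤ 2H(1-x) with 2x ≤ 1+x. -/
theorem mul_slope_mul_hypergeom_one_sub_le (ha : 0 < a) (hac : a < c) (hc : c ≤ 1) {x : ℝ}
    (hx : x ∈ Ioo (0 : ℝ) 1) :
    x * zeroBalancedSlope a c x * ₂F₁ a (c - a) c (1 - x)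
      ≤ (1 + x) * zeroBalancedSlope a c (1 - x) * ₂F₁ a (c - a) c x := by
  have hx' := one_sub_mem_Ioo hx
  have h1 := one_le_hypergeom ha hac hc (Ioo_subset_Ico_self hx)
  have h2 := one_le_hypergeom ha hac hc (Ioo_subset_Ico_self hx')
  have h3 := zeroBalancedSlope_pos ha hac hc (Ioo_subset_Ico_self hx)
  have h4 := zeroBalancedSlope_pos ha hac hc (Ioo_subset_Ico_self hx')
  have hx0 := hx.1
  have hx1 := hx'.1
  rcases le_total x (1 - x) with h | h
  · have h5 := hypergeom_mul_one_sub_le ha hac hc (Ioo_subset_Ico_self hx')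
    rw [sub_sub_cancel] at h5
    have h6 : zeroBalancedSlope a c x ≤ zeroBalancedSlope a c (1 - x) :=
      tsum_mul_pow_le (fun n => (zeroBalancedSlopeCoeff_pos ha hac n).le)
        (zeroBalancedSlopeCoeff_le_one ha hac hc) hx0.le h hx'.2
    calc x * zeroBalancedSlope a c x * ₂F₁ a (c - a) c (1 - x)
        = x * ₂F₁ a (c - a) c (1 - x) * zeroBalancedSlope a c x := by ring
      _ ≤ 1 * zeroBalancedSlope a c (1 - x) := by gcongr
      _ ≤ (1 + x) * zeroBalancedSlope a c (1 - x) * 1 := by nlinarith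
      _ ≤ _ := by gcongr
  · have h5 : ₂F₁ a (c - a) c (1 - x) ≤ ₂F₁ a (c - a) c x := by
      rw [hypergeom_eq_tsum, hypergeom_eq_tsum]
      exact tsum_mul_pow_le (fun n => (zeroBalancedCoeff_pos ha hac n).le)
        (zeroBalancedCoeff_le_one ha hac hc) hx1.le h hx.2
    have h6 := zeroBalancedSlope_le ha hac hc (Ioo_subset_Ico_self hx)
    have h7 := le_zeroBalancedSlope ha hac hc (Ioo_subset_Ico_self hx')
    have h8 : x * zeroBalancedSlope a c x ≤ (1 + x) * zeroBalancedSlope a c (1 - x) := by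
      nlinarith
    gcongr

theorem strictAntiOn_legendreM_div (ha : 0 < a) (hac : a < c) (hc : c ≤ 1) :
    StrictAntiOn (fun r => legendreM a c (r ^ 2) / (r * (1 + r) * ₂F₁ a (c - a) c (r ^ 2) ^ 2))
      (Ioo 0 1) := by
  have hd : ∀ r ∈ Ioo (0 : ℝ) 1, ∃ d, d < 0 ∧ HasDerivAt (fun r => legendreM a c (r ^ 2) /
      (r * (1 + r) * ₂F₁ a (c - a) c (r ^ 2) ^ 2)) d r := by
    intro r hr
    have hx := sq_mem_Ioo hr
    have hF : HasDerivAt (fun r => ₂F₁ a (c - a) c (r ^ 2)) _ r :=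
      HasDerivAt.comp (h := fun r : ℝ => r ^ 2) r (hasDerivAt_hypergeom ha hac hc hx) (hasDerivAt_pow 2 r)
    have hM : HasDerivAt (fun r => legendreM a c (r ^ 2)) _ r :=
      HasDerivAt.comp (h := fun r : ℝ => r ^ 2) r (hasDerivAt_legendreM ha hac hc hx) (hasDerivAt_pow 2 r)
    have hx' := one_sub_mem_Ioo hx
    have h1 := one_le_hypergeom ha hac hc (Ioo_subset_Ico_self hx)
    have h2 := one_le_hypergeom ha hac hc (Ioo_subset_Ico_self hx')
    have h3 := zeroBalancedSlope_pos ha hac hc (Ioo_subset_Ico_self hx)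
    have h4 := zeroBalancedSlope_pos ha hac hc (Ioo_subset_Ico_self hx')
    have h5 := mul_slope_mul_hypergeom_one_sub_le ha hac hc hx
    have hr0 := hr.1
    have hr1 := hx'.1
    have hF0 : 0 < ₂F₁ a (c - a) c (r ^ 2) := by linarith
    have hden : r * (1 + r) * ₂F₁ a (c - a) c (r ^ 2) ^ 2 ≠ 0 := by positivity
    refine ⟨_, ?_, hM.div (((hasDerivAt_id r).mul ((hasDerivAt_id r).const_add 1)).mul
      (hF.pow 2)) hden⟩
    have hM0 := legendreM_pos ha hac hc hx
    have hMeq : legendreM a c (r ^ 2) = (1 - r ^ 2) * zeroBalancedSlope a c (1 - r ^ 2)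
        * ₂F₁ a (c - a) c (r ^ 2) + r ^ 2 * zeroBalancedSlope a c (r ^ 2)
        * ₂F₁ a (c - a) c (1 - r ^ 2) := rfl
    simp only [id, Pi.mul_apply]
    generalize legendreM a c (r ^ 2) = M at *
    generalize ₂F₁ a (c - a) c (r ^ 2) = F at *
    generalize ₂F₁ a (c - a) c (1 - r ^ 2) = G at *
    generalize zeroBalancedSlope a c (r ^ 2) = H at *
    generalize zeroBalancedSlope a c (1 - r ^ 2) = K at *
    refine div_neg_of_neg_of_pos ?_ (by positivity)
    have hc0 := ha.trans hac
    -- This is 2xM' ≤ M at x = r², so M(r²)/r does not increase; the factors 1+r and F² in the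
    -- denominator then give strictness.
    have e1 : 2 * r ^ 2 * ((1 - c) * (H * G - K * F)) ≤ M := by
      have e2 : r ^ 2 * (2 * (H * G - K * F)) ≤ M := by rw [hMeq]; linarith
      rcases le_total (H * G - K * F) 0 with h | h
      · have : (1 - c) * (H * G - K * F) ≤ 0 :=
          mul_nonpos_of_nonneg_of_nonpos (by linarith) h
        nlinarith
      · have : (1 - c) * (H * G - K * F) ≤ H * G - K * F := by nlinarith
        nlinarith
    have key : F ^ 2 * ((1 + r) * (2 * r ^ 2 * ((1 - c) * (H * G - K * F)) - M)
        - M * r - M * (1 + r) * (4 * r ^ 2 * (H / (1 - r ^ 2)) / F)) < 0 := by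
      refine mul_neg_of_pos_of_neg (by positivity) ?_
      have e3 : (1 + r) * (2 * r ^ 2 * ((1 - c) * (H * G - K * F)) - M) ≤ 0 :=
        mul_nonpos_of_nonneg_of_nonpos (by positivity) (by linarith)
      have e4 : 0 < M * r := by positivity
      have e5 : 0 ≤ M * (1 + r) * (4 * r ^ 2 * (H / (1 - r ^ 2)) / F) := by positivity
      linarith
    refine lt_of_eq_of_lt ?_ key
    push_cast
    field_simp
    ring
  refine strictAntiOn_of_deriv_neg (convex_Ioo 0 1) (fun x hx => ?_) fun x hx => ?_
  · obtain ⟨d, -, h⟩ := hd x hx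
    exact h.continuousAt.continuousWithinAt
  · rw [interior_Ioo] at hx
    obtain ⟨d, h0, h⟩ := hd x hx
    rwa [h.deriv]

/-! ### Derivative of the modulus and the mean inequalities -/

theorem hasDerivAt_genModulusTwo (ha : 0 < a) (hac : a < c) (hc : c ≤ 1) {r : ℝ}
    (hr : r ∈ Ioo (0 : ℝ) 1) :
    HasDerivAt (genModulusTwo a c) (-(ProbabilityTheory.beta a (c - a) * (legendreM a c (r ^ 2) /
      (r * (1 - r ^ 2) * ₂F₁ a (c - a) c (r ^ 2) ^ 2)))) r := by
  have hx := sq_mem_Ioo hr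
  have hx' := one_sub_mem_Ioo hx
  have hr0 := hr.1.ne'
  have hr1 := hx'.1.ne'
  have hF0 : ₂F₁ a (c - a) c (r ^ 2) ≠ 0 :=
    (one_pos.trans_le (one_le_hypergeom ha hac hc (Ioo_subset_Ico_self hx))).ne'
  have hF : HasDerivAt (fun r => ₂F₁ a (c - a) c (r ^ 2)) _ r :=
    HasDerivAt.comp (h := fun r : ℝ => r ^ 2) r (hasDerivAt_hypergeom ha hac hc hx) (hasDerivAt_pow 2 r)
  have hG : HasDerivAt (fun r => ₂F₁ a (c - a) c (1 - r ^ 2)) _ r :=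
    HasDerivAt.comp (h := fun r : ℝ => r ^ 2) r (hasDerivAt_hypergeom_one_sub ha hac hc hx) (hasDerivAt_pow 2 r)
  have hd := (hG.div hF hF0).const_mul (ProbabilityTheory.beta a (c - a) / 2)
  refine (hd.congr_of_eventuallyEq ?_).congr_deriv ?_
  · filter_upwards [Ioo_mem_nhds hr.1 hr.2] with s hs
    simp only [genModulusTwo, genModulus, Real.sq_sqrt (one_sub_mem_Ioo (sq_mem_Ioo hs)).1.le,
      Pi.div_apply]
  · rw [legendreM]
    push_cast
    field_simp
    ring

theorem strictAntiOn_mul_deriv_genModulusTwo (ha : 0 < a) (hac : a < c) (hc : c ≤ 1) :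
    StrictAntiOn (fun r : ℝ => r * deriv (genModulusTwo a c) r) (Ioo 0 1) := by
  have hB := ProbabilityTheory.beta_pos ha (sub_pos.2 hac)
  have heq : ∀ r ∈ Ioo (0 : ℝ) 1, r * deriv (genModulusTwo a c) r
      = -(ProbabilityTheory.beta a (c - a) * (legendreM a c (r ^ 2) /
        ((1 - r ^ 2) * ₂F₁ a (c - a) c (r ^ 2) ^ 2))) := by
    intro r hr
    rw [(hasDerivAt_genModulusTwo ha hac hc hr).deriv]
    have hr0 := hr.1.ne'
    field_simp
  intro r hr s hs hrs
  simp only [heq r hr, heq s hs, neg_lt_neg_iff]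
  exact mul_lt_mul_of_pos_left (strictMonoOn_legendreM_div ha hac hc (sq_mem_Ioo hr)
    (sq_mem_Ioo hs) (pow_lt_pow_left₀ hrs hr.1.le two_ne_zero)) hB

theorem strictMonoOn_one_sub_mul_deriv_genModulusTwo (ha : 0 < a) (hac : a < c) (hc : c ≤ 1) :
    StrictMonoOn (fun r : ℝ => (1 - r) * deriv (genModulusTwo a c) r) (Ioo 0 1) := by
  have hB := ProbabilityTheory.beta_pos ha (sub_pos.2 hac)
  have heq : ∀ r ∈ Ioo (0 : ℝ) 1, (1 - r) * deriv (genModulusTwo a c) r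
      = -(ProbabilityTheory.beta a (c - a) * (legendreM a c (r ^ 2) /
        (r * (1 + r) * ₂F₁ a (c - a) c (r ^ 2) ^ 2))) := by
    intro r hr
    rw [(hasDerivAt_genModulusTwo ha hac hc hr).deriv]
    have hr0 := (sub_pos.2 hr.2).ne'
    have hsq : 1 - r ^ 2 = (1 - r) * (1 + r) := by ring
    rw [hsq]
    field_simp
  intro r hr s hs hrs
  simp only [heq r hr, heq s hs, neg_lt_neg_iff]
  exact mul_lt_mul_of_pos_left (strictAntiOn_legendreM_div ha hac hc hr hs hrs) hB

end

theorem mainTheorem6 (a c : ℝ) (ha : 0 < a) (hac : a < c) (hc : c ≤ 1) :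
    DifferentiableOn ℝ (genModulusTwo a c) (Set.Ioo 0 1) ∧
    StrictMonoOn (fun r : ℝ => (1 - r) * deriv (genModulusTwo a c) r) (Set.Ioo 0 1) ∧
    StrictAntiOn (fun r : ℝ => r * deriv (genModulusTwo a c) r) (Set.Ioo 0 1) ∧
    ∀ u ∈ Set.Ioo (0 : ℝ) 1, ∀ t ∈ Set.Ioo (0 : ℝ) 1,
      genModulusTwo a c (1 - Real.sqrt ((1 - u) * (1 - t)))
          ≤ (genModulusTwo a c u + genModulusTwo a c t) / 2 ∧
      (genModulusTwo a c u + genModulusTwo a c t) / 2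
          ≤ genModulusTwo a c (Real.sqrt (u * t)) ∧
      (genModulusTwo a c (1 - Real.sqrt ((1 - u) * (1 - t)))
          = (genModulusTwo a c u + genModulusTwo a c t) / 2 ↔ u = t) ∧
      ((genModulusTwo a c u + genModulusTwo a c t) / 2
          = genModulusTwo a c (Real.sqrt (u * t)) ↔ u = t) := by
  have hdiff : DifferentiableOn ℝ (genModulusTwo a c) (Ioo 0 1) := fun r hr =>
    (hasDerivAt_genModulusTwo ha hac hc hr).differentiableAt.differentiableWithinAt
  have hmono := strictMonoOn_one_sub_mul_deriv_genModulusTwo ha hac hc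
  have hanti := strictAntiOn_mul_deriv_genModulusTwo ha hac hc
  refine ⟨hdiff, hmono, hanti, fun u hu t ht => ?_⟩
  -- The reflection r ↦ -μ(1-r) turns the increase of (1-r)μ'(r) into the decrease required by the
  -- concavity lemma; its geometric mean is that of 1-u and 1-t.
  have hdg : ∀ r ∈ Ioo (0 : ℝ) 1, HasDerivAt (fun r => -genModulusTwo a c (1 - r))
      (deriv (genModulusTwo a c) (1 - r)) r := fun r hr => by
    have h := (hasDerivAt_genModulusTwo ha hac hc
      (one_sub_mem_Ioo hr)).differentiableAt.hasDerivAt.comp_const_sub 1 r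
    exact h.neg.congr_deriv (neg_neg _)
  have hganti : StrictAntiOn (fun r => r * deriv (fun r => -genModulusTwo a c (1 - r)) r)
      (Ioo 0 1) := by
    intro r hr s hs hrs
    simp only [(hdg r hr).deriv, (hdg s hs).deriv]
    simpa using hmono (one_sub_mem_Ioo hs) (one_sub_mem_Ioo hr) (sub_lt_sub_left hrs 1)
  have hright := strict_geom_midpoint_concave hdiff hanti hu ht
  have hleft : u ≠ t → genModulusTwo a c (1 - Real.sqrt ((1 - u) * (1 - t)))
      < (genModulusTwo a c u + genModulusTwo a c t) / 2 := fun hne => by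
    have := strict_geom_midpoint_concave
      (fun r hr => (hdg r hr).differentiableAt.differentiableWithinAt) hganti
      (one_sub_mem_Ioo hu) (one_sub_mem_Ioo ht) (fun h => hne (by linarith))
    simp only [sub_sub_cancel] at this
    linarith
  rcases eq_or_ne u t with rfl | hne
  · rw [Real.sqrt_mul_self hu.1.le, Real.sqrt_mul_self (one_sub_mem_Ioo hu).1.le, sub_sub_cancel,
      add_self_div_two]
    simp
  · exact ⟨(hleft hne).le, (hright hne).le, iff_of_false (hleft hne).ne hne,
      iff_of_false (hright hne).ne hne⟩
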